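/- **Setting.** A (non-initialized) graphical game consists of a finite digraph $G=(V,E)$; a partition $V=V_1\cup\dots\cup V_n\cup V_R\cup V_T$ (parts may be empty), where there are no moves (arcs) from the terminal positions $v\in V_T$ and at least one move from every other position; for each chance position $v\in V_R$ a probability distribution $q(v)$ on the moves from $v$ (zero probabilities are allowed); and a payoff $u:I\times(V_T\cup\{c\})\to\mathbb{R}$, where $I=\{1,\dots,n\}$ is the set of players and $c$ is the outcome of all infinite plays. An independently mixed strategy of player $i$ assigns to each position $v\in V_i$ a probability distribution on the moves from $v$. A profile $y$ of such strategies defines a Markov chain on $V$: in each non-terminal position the next position is drawn from the corresponding distribution, afresh at each visit, and the play stops at $V_T$ (Markov realization). For an initial position $v_0\in V\setminus V_T$ let $P(a,v_0)$, $a\in V_T$, be the limit as $k\to\infty$ of the probability that the play has terminated in $a$ after at most $k$ moves, and $P(c,v_0)$ the limit of the probability that it has not terminated after $k$ moves. The effective payoff of player $i$ is $\sum_{a\in V_T}P(a,v_0)\,u(i,a)+P(c,v_0)\,u(i,c)$. The profile $y$ is a Nash equilibrium (NE) of the game initialized in $v_0$ if no player can increase his effective payoff by replacing his own independently mixed strategy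 by another one while the others keep theirs; $y$ is a uniform Nash equilibrium if it is a NE of the game initialized in $v_0$ for every $v_0\in V\setminus V_T$. Given a probability distribution $q(v_0)$ on $V\setminus V_T$, the initializing extension of the game is obtained by adding a new chance position $v_0$ with a move $(v_0,v)$ to every $v\in V\setminus V_T$, chosen with probability $q(v_0,v)$, and no moves into $v_0$; it is initialized in $v_0$ and has the same payoff $u$. The players control the same positions with the same moves, so every profile $y$ of the game is also a profile of the extension. **Proposition 2.** Let $y$ be a profile of independently mixed strategies in a non-initialized graphical game. (i) If $y$ is a uniform Nash equilibrium of the game, then $y$ is a NE of its initializing extension for every probability distribution $q(v_0)$ on $V\setminus V_T$. (ii) If $y$ is a NE of the initializing extension for some strictly positive distribution $q(v_0)$ (that is, $q(v_0,v)>0$ for all $v\in V\setminus V_T$), then $y$ is a uniform Nash equilibrium of the game. -/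

import Mathlib

open Filter Topology

/-- Who moves in a position: a player `i`, chance, or nobody (the position is terminal).
A map from the positions to this type is a partition `V = ⋃ᵢ Vᵢ ∪ V_R ∪ V_T`
(with possibly empty parts). -/
inductive Controller (I : Type*) : Type _
  | player (i : I) : Controller I
  | chance : Controller I
  | terminal : Controller I

instance Controller.decidableEqTerminal {I : Type*} (c : Controller I) :
    Decidable (c = Controller.terminal) :=
  match c with
  | .player _ => isFalse nofun
  | .chance => isFalse nofun
  | .terminal => isTrue rfl

/-- `p` is a probability distribution on the finite set `V` that is concentrated on `S`. -/
def IsDistributionOn {V : Type*} [Fintype V] (S : Set V) (p : V → ℝ) : Prop :=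
  (∀ w, 0 ≤ p w) ∧ (∀ w, w ∉ S → p w = 0) ∧ ∑ w, p w = 1

/-- A (non-initialized) graphical game structure `(G, D, q)`: a digraph `G` on a finite set of
positions, the partition `D` of the positions, and for every chance position a probability
distribution on the moves from it (probability `0` is allowed). -/
structure GameStructure (I V : Type*) [Fintype V] where
  graph : Digraph V
  controller : V → Controller I
  /-- there are no moves from terminal positions -/
  no_move : ∀ v, controller v = .terminal → ∀ w, ¬ graph.Adj v w
  /-- there is a move from every other position -/
  exists_move : ∀ v, controller v ≠ .terminal → ∃ w, graph.Adj v w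
  q : ∀ v, controller v = .chance → V → ℝ
  q_dist : ∀ v h, IsDistributionOn {w | graph.Adj v w} (q v h)

namespace GameStructure

noncomputable section

variable {I V : Type*} [Fintype V]

/-- The set `V_T` of terminal positions. -/
abbrev Terminal (G : GameStructure I V) : Type _ := {v : V // G.controller v = .terminal}

/-- The outcomes: the terminal positions `some a`, and the outcome `c = none` of all
infinite plays. -/
abbrev Outcome (G : GameStructure I V) : Type _ := Option G.Terminal

/-- An independently mixed strategy of player `i`: for each position controlled by `i`, a
probability distribution on the moves from this position. -/
@[ext]
structure Strategy (G : GameStructure I V) (i : I) where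
  prob : ∀ v, G.controller v = .player i → V → ℝ
  prob_dist : ∀ v h, IsDistributionOn {w | G.graph.Adj v w} (prob v h)

/-- A situation (strategy profile) in independently mixed strategies. -/
abbrev Profile (G : GameStructure I V) : Type _ := ∀ i, G.Strategy i

section Markov

variable [DecidableEq V]

/-- The Markov chain defined by a situation: in each non-terminal position the next position is
chosen by the distribution of its controller, afresh at each visit; a play that has reached a
terminal position stays there. -/
def transition (G : GameStructure I V) (y : G.Profile) : Matrix V V ℝ := fun v w =>
  match h : G.controller v with
  | .player i => (y i).prob v h w
  | .chance => G.q v h w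
  | .terminal => if w = v then 1 else 0

/-- The probability that the play that starts in `v` is in the terminal position `a` after (at
most) `k` moves. -/
def probTerminated (G : GameStructure I V) (y : G.Profile) (v : V) (a : G.Terminal) (k : ℕ) : ℝ :=
  (G.transition y ^ k) v a

/-- The probability that the play that starts in `v` has not terminated after `k` moves. -/
def probRunning (G : GameStructure I V) (y : G.Profile) (v : V) (k : ℕ) : ℝ :=
  ∑ w with G.controller w ≠ .terminal, (G.transition y ^ k) v w

/-- The limiting distribution on the outcomes of the Markov realization, for the initial
position `v`. The limits exist: see `tendsto_probTerminated`, `tendsto_probRunning`. -/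
def limitDistribution (G : GameStructure I V) (y : G.Profile) (v : V) : G.Outcome → ℝ
  | some a => limUnder atTop (G.probTerminated y v a)
  | none => limUnder atTop (G.probRunning y v)

/-- The effective payoff of player `i` under the Markov realization, for the initial
position `v`. -/
def effectivePayoff (G : GameStructure I V) (u : I → G.Outcome → ℝ) (y : G.Profile) (v : V)
    (i : I) : ℝ :=
  ∑ o : G.Outcome, G.limitDistribution y v o * u i o

/-- `y` is a Nash equilibrium, in independently mixed strategies and under the Markov
realization, of the game initialized in `v₀`. -/
def IsNE (G : GameStructure I V) (u : I → G.Outcome → ℝ) (v₀ : V) (y : G.Profile) : Prop :=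
  ∀ (i : I) (y' : G.Profile), (∀ j, j ≠ i → y' j = y j) →
    G.effectivePayoff u y' v₀ i ≤ G.effectivePayoff u y v₀ i

/-- `y` is a uniform Nash equilibrium: a Nash equilibrium for every non-terminal initial
position. -/
def IsUNE (G : GameStructure I V) (u : I → G.Outcome → ℝ) (y : G.Profile) : Prop :=
  ∀ v, G.controller v ≠ .terminal → G.IsNE u v y

/-! The limits in the definition of the limiting distribution exist. -/

theorem transition_of_terminal (G : GameStructure I V) (y : G.Profile) {v : V}
    (hv : G.controller v = .terminal) (w : V) :
    G.transition y v w = if w = v then 1 else 0 := by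
  unfold transition
  split <;> simp_all

theorem transition_nonneg (G : GameStructure I V) (y : G.Profile) (v w : V) :
    0 ≤ G.transition y v w := by
  unfold transition
  split
  · exact ((y _).prob_dist v _).1 w
  · exact (G.q_dist v _).1 w
  · split <;> norm_num

theorem sum_transition (G : GameStructure I V) (y : G.Profile) (v : V) :
    ∑ w, G.transition y v w = 1 := by
  unfold transition
  split
  · exact ((y _).prob_dist v _).2.2
  · exact (G.q_dist v _).2.2
  · simp

theorem transition_pow_nonneg (G : GameStructure I V) (y : G.Profile) (k : ℕ) (v w : V) :
    0 ≤ (G.transition y ^ k) v w := by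
  induction k generalizing w with
  | zero => rw [pow_zero, Matrix.one_apply]; split <;> norm_num
  | succ k ih =>
    rw [pow_succ, Matrix.mul_apply]
    exact Finset.sum_nonneg fun x _ => mul_nonneg (ih x) (G.transition_nonneg y x w)

theorem sum_transition_pow (G : GameStructure I V) (y : G.Profile) (k : ℕ) (v : V) :
    ∑ w, (G.transition y ^ k) v w = 1 := by
  induction k with
  | zero => simp [Matrix.one_apply]
  | succ k ih =>
    simp_rw [pow_succ, Matrix.mul_apply]
    rw [Finset.sum_comm]
    simp_rw [← Finset.mul_sum, sum_transition, mul_one]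
    exact ih

theorem monotone_probTerminated (G : GameStructure I V) (y : G.Profile) (v : V)
    (a : G.Terminal) : Monotone (G.probTerminated y v a) := by
  refine monotone_nat_of_le_succ fun k => ?_
  unfold probTerminated
  rw [pow_succ, Matrix.mul_apply]
  calc (G.transition y ^ k) v a
      = (G.transition y ^ k) v a * G.transition y a a := by
        rw [G.transition_of_terminal y a.2]; simp
    _ ≤ _ := Finset.single_le_sum
        (f := fun x => (G.transition y ^ k) v x * G.transition y x a)
        (fun x _ => mul_nonneg (G.transition_pow_nonneg y k v x) (G.transition_nonneg y x a))
        (Finset.mem_univ a.1)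

theorem tendsto_probTerminated (G : GameStructure I V) (y : G.Profile) (v : V)
    (a : G.Terminal) :
    Tendsto (G.probTerminated y v a) atTop (𝓝 (G.limitDistribution y v (some a))) := by
  refine tendsto_nhds_limUnder ⟨_, tendsto_atTop_ciSup (G.monotone_probTerminated y v a) ⟨1, ?_⟩⟩
  rintro _ ⟨k, rfl⟩
  rw [← G.sum_transition_pow y k v]
  exact Finset.single_le_sum (f := fun x => (G.transition y ^ k) v x)
    (fun x _ => G.transition_pow_nonneg y k v x) (Finset.mem_univ a.1)

theorem sum_probTerminated_add_probRunning (G : GameStructure I V) (y : G.Profile) (v : V)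
    (k : ℕ) : ∑ a, G.probTerminated y v a k + G.probRunning y v k = 1 := by
  rw [← G.sum_transition_pow y k v,
    ← Finset.sum_filter_add_sum_filter_not Finset.univ (fun w => G.controller w = .terminal)]
  congr 1
  rw [Finset.sum_subtype (p := fun w => G.controller w = .terminal) _ (by simp)]
  rfl

theorem tendsto_probRunning (G : GameStructure I V) (y : G.Profile) (v : V) :
    Tendsto (G.probRunning y v) atTop (𝓝 (G.limitDistribution y v none)) := by
  refine tendsto_nhds_limUnder ⟨1 - ∑ a, G.limitDistribution y v (some a), ?_⟩
  have h : G.probRunning y v = fun k => 1 - ∑ a, G.probTerminated y v a k := by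
    funext k
    linarith [G.sum_probTerminated_add_probRunning y v k]
  rw [h]
  exact tendsto_const_nhds.sub (tendsto_finsetSum _ fun a _ => G.tendsto_probTerminated y v a)

end Markov

section Extension

/-- A probability distribution on the non-terminal positions. -/
abbrev IsInitialDistribution (G : GameStructure I V) (q₀ : V → ℝ) : Prop :=
  IsDistributionOn {v | G.controller v ≠ .terminal} q₀

theorem IsInitialDistribution.exists_nonterminal {G : GameStructure I V} {q₀ : V → ℝ}
    (h : G.IsInitialDistribution q₀) : ∃ v, G.controller v ≠ .terminal := by
  by_contra! hc
  have h0 : ∑ v, q₀ v = 0 := Finset.sum_eq_zero fun v _ => h.2.1 v (fun hv => hv (hc v))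
  exact zero_ne_one (h0.symm.trans h.2.2)

/-- The function on `Option V` that extends `p` by `0`. -/
def extendZero (p : V → ℝ) : Option V → ℝ
  | none => 0
  | some v => p v

theorem isDistributionOn_extendZero {S : Set V} {T : Set (Option V)} {p : V → ℝ}
    (h : IsDistributionOn S p) (hST : ∀ v, v ∈ S → some v ∈ T) :
    IsDistributionOn T (extendZero p) := by
  refine ⟨?_, ?_, ?_⟩
  · rintro (_ | v)
    · exact le_rfl
    · exact h.1 v
  · rintro (_ | v) hv
    · rfl
    · exact h.2.1 v fun hs => hv (hST v hs)
  · rw [Fintype.sum_option]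
    simpa [extendZero] using h.2.2

/-- The digraph of the initializing extension: a new position `none`, with a move to every
non-terminal old position and no move into it. -/
def extensionGraph (G : GameStructure I V) : Digraph (Option V) where
  Adj
    | none, some w => G.controller w ≠ .terminal
    | some v, some w => G.graph.Adj v w
    | _, none => False

/-- In the initializing extension the new position is a position of chance. -/
def extensionController (G : GameStructure I V) : Option V → Controller I
  | none => .chance
  | some v => G.controller v

/-- The initializing extension of `G` by the distribution `q₀`; its initial position
is `none`. -/
def extension (G : GameStructure I V) (q₀ : V → ℝ) (hq₀ : G.IsInitialDistribution q₀) :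
    GameStructure I (Option V) where
  graph := G.extensionGraph
  controller := G.extensionController
  no_move
    | some v, h, some w => G.no_move v h w
    | some _, _, none => id
  exists_move
    | none, _ => hq₀.exists_nonterminal.imp' some fun _ hv => hv
    | some v, h => (G.exists_move v h).imp' some fun _ hw => hw
  q
    | none, _ => extendZero q₀
    | some v, h => extendZero (G.q v h)
  q_dist
    | none, _ => isDistributionOn_extendZero hq₀ fun _ hv => hv
    | some v, h => isDistributionOn_extendZero (G.q_dist v h) fun _ hw => hw

variable (G : GameStructure I V) (q₀ : V → ℝ) (hq₀ : G.IsInitialDistribution q₀)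

/-- The extension has the same outcomes, hence a payoff of `G` is a payoff of the extension. -/
def extensionPayoff (u : I → G.Outcome → ℝ) : I → (G.extension q₀ hq₀).Outcome → ℝ
  | i, none => u i none
  | i, some ⟨some a, h⟩ => u i (some ⟨a, h⟩)

/-- In the extension each player controls the same positions, with the same moves, hence a
situation `y` of `G` is a situation of the extension. -/
def extensionProfile (y : G.Profile) : (G.extension q₀ hq₀).Profile := fun i =>
  { prob := fun
      | some v, h => extendZero ((y i).prob v h)
    prob_dist := fun
      | some v, h => isDistributionOn_extendZero ((y i).prob_dist v h) fun _ hw => hw }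

end Extension

end

end GameStructure

/-! In the extension the effective payoff is the `q₀`-average of the effective payoffs of `G` over
the initial positions (`extension_effectivePayoff`), so (i) follows by averaging inequalities. For
(ii), a deviation profitable from one `v` may lose elsewhere. The average detects it only if player
`i` has one response that is optimal from all positions at once (`exists_uniform_best_response`):
this response is nowhere worse than `y` and strictly better at `v`, where `q₀` is positive.

Such a response is found by discounting. Without discounting, the one-step equations may have
several solutions, because the chain can run forever; with a factor `β < 1` per move a maximum
principle holds. Policy improvement over the finitely many pure positional strategies then gives a
uniform best response for each `β` (`exists_pure_discounted_best_response`). Discounted payoffs tend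
to the effective ones as `β → 1`, and finiteness of the set of pure strategies carries the
conclusion to the limit. -/

namespace GameStructure

noncomputable section

/-! ### Discounted absorption probabilities and the maximum principle -/

section Discounting

variable {I V : Type*} [Fintype V] [DecidableEq V] (G : GameStructure I V)

/-- The transition matrix in which every row of a non-terminal position is multiplied by `β`. -/
def discountedTransition (β : ℝ) (y : G.Profile) : Matrix V V ℝ := fun v w =>
  (if G.controller v = .terminal then 1 else β) * G.transition y v w

variable {G}

theorem discountedTransition_nonneg {β : ℝ} (hβ : 0 ≤ β) (y : G.Profile) (v w : V) :
    0 ≤ G.discountedTransition β y v w :=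
  mul_nonneg (by split_ifs <;> positivity) (G.transition_nonneg y v w)

theorem discountedTransition_one (y : G.Profile) :
    G.discountedTransition 1 y = G.transition y := by
  ext v w
  simp [discountedTransition]

theorem discountedTransition_of_terminal (β : ℝ) (y : G.Profile) {v : V}
    (hv : G.controller v = .terminal) (w : V) :
    G.discountedTransition β y v w = if w = v then 1 else 0 := by
  simp [discountedTransition, hv, G.transition_of_terminal y hv]

theorem discountedTransition_le {β : ℝ} (hβ : β ≤ 1) (y : G.Profile) (v w : V) :
    G.discountedTransition β y v w ≤ G.transition y v w :=
  mul_le_of_le_one_left (G.transition_nonneg y v w) (by split_ifs <;> linarith)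

theorem discountedTransition_pow_nonneg {β : ℝ} (hβ : 0 ≤ β) (y : G.Profile) (k : ℕ)
    (v w : V) : 0 ≤ (G.discountedTransition β y ^ k) v w := by
  induction k generalizing w with
  | zero => rw [pow_zero, Matrix.one_apply]; split <;> norm_num
  | succ k ih =>
    rw [pow_succ, Matrix.mul_apply]
    exact Finset.sum_nonneg fun x _ => mul_nonneg (ih x) (discountedTransition_nonneg hβ y x w)

theorem discountedTransition_pow_le {β : ℝ} (hβ : 0 ≤ β) (hβ' : β ≤ 1) (y : G.Profile) (k : ℕ)
    (v w : V) : (G.discountedTransition β y ^ k) v w ≤ (G.transition y ^ k) v w := by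
  induction k generalizing w with
  | zero => simp
  | succ k ih =>
    simp only [pow_succ, Matrix.mul_apply]
    exact Finset.sum_le_sum fun x _ => mul_le_mul (ih x) (discountedTransition_le hβ' y x w)
      (discountedTransition_nonneg hβ y x w) (G.transition_pow_nonneg y k v x)

theorem continuous_discountedTransition_pow (y : G.Profile) (k : ℕ) (v w : V) :
    Continuous fun β => (G.discountedTransition β y ^ k) v w := by
  induction k generalizing w with
  | zero => simpa using continuous_const
  | succ k ih =>
    simp only [pow_succ, Matrix.mul_apply]
    refine continuous_finsetSum _ fun x _ => (ih x).mul ?_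
    unfold discountedTransition
    split_ifs <;> fun_prop

theorem monotone_discountedTransition_pow {β : ℝ} (hβ : 0 ≤ β) (y : G.Profile) (v : V)
    (a : G.Terminal) : Monotone fun k => (G.discountedTransition β y ^ k) v a := by
  refine monotone_nat_of_le_succ fun k => ?_
  rw [pow_succ, Matrix.mul_apply]
  calc (G.discountedTransition β y ^ k) v a
      = (G.discountedTransition β y ^ k) v a * G.discountedTransition β y a a := by
        rw [discountedTransition_of_terminal β y a.2]; simp
    _ ≤ _ := Finset.single_le_sum
        (f := fun x => (G.discountedTransition β y ^ k) v x * G.discountedTransition β y x a)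
        (fun x _ => mul_nonneg (discountedTransition_pow_nonneg hβ y k v x)
          (discountedTransition_nonneg hβ y x a))
        (Finset.mem_univ a.1)

variable (G) in
/-- The expectation of `β ^ k`, where `k` is the number of moves until the play
terminates in `a`. -/
def discountedProb (β : ℝ) (y : G.Profile) (v : V) (a : G.Terminal) : ℝ :=
  ⨆ k, (G.discountedTransition β y ^ k) v a

theorem probTerminated_le_limitDistribution (y : G.Profile) (v : V) (a : G.Terminal) (k : ℕ) :
    (G.transition y ^ k) v a ≤ G.limitDistribution y v (some a) :=
  (G.monotone_probTerminated y v a).ge_of_tendsto (G.tendsto_probTerminated y v a) k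

theorem discountedTransition_pow_le_limitDistribution {β : ℝ} (hβ : 0 ≤ β) (hβ' : β ≤ 1)
    (y : G.Profile) (v : V) (a : G.Terminal) (k : ℕ) :
    (G.discountedTransition β y ^ k) v a ≤ G.limitDistribution y v (some a) :=
  (discountedTransition_pow_le hβ hβ' y k v a).trans (probTerminated_le_limitDistribution y v a k)

theorem bddAbove_discountedTransition_pow {β : ℝ} (hβ : 0 ≤ β) (hβ' : β ≤ 1)
    (y : G.Profile) (v : V) (a : G.Terminal) :
    BddAbove (Set.range fun k => (G.discountedTransition β y ^ k) v a) := by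
  refine ⟨G.limitDistribution y v (some a), ?_⟩
  rintro _ ⟨k, rfl⟩
  exact discountedTransition_pow_le_limitDistribution hβ hβ' y v a k

theorem tendsto_discountedTransition_pow {β : ℝ} (hβ : 0 ≤ β) (hβ' : β ≤ 1)
    (y : G.Profile) (v : V) (a : G.Terminal) :
    Tendsto (fun k => (G.discountedTransition β y ^ k) v a) atTop
      (𝓝 (G.discountedProb β y v a)) :=
  tendsto_atTop_ciSup (monotone_discountedTransition_pow hβ y v a)
    (bddAbove_discountedTransition_pow hβ hβ' y v a)

theorem discountedProb_eq_sum {β : ℝ} (hβ : 0 ≤ β) (hβ' : β ≤ 1)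
    (y : G.Profile) (v : V) (a : G.Terminal) :
    G.discountedProb β y v a =
      ∑ w, G.discountedTransition β y v w * G.discountedProb β y w a := by
  refine tendsto_nhds_unique
    ((tendsto_discountedTransition_pow hβ hβ' y v a).comp (tendsto_add_atTop_nat 1)) ?_
  simp only [Function.comp_def, pow_succ', Matrix.mul_apply]
  exact tendsto_finsetSum _ fun w _ =>
    (tendsto_discountedTransition_pow hβ hβ' y w a).const_mul _

theorem discountedTransition_pow_of_terminal (β : ℝ) (y : G.Profile) {v : V}
    (hv : G.controller v = .terminal) (k : ℕ) (w : V) :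
    (G.discountedTransition β y ^ k) v w = if w = v then 1 else 0 := by
  induction k with
  | zero => simp [Matrix.one_apply, eq_comm]
  | succ k ih =>
    rw [pow_succ', Matrix.mul_apply]
    simp [discountedTransition_of_terminal β y hv, ih]

theorem discountedProb_of_terminal (β : ℝ) (y : G.Profile) {v : V}
    (hv : G.controller v = .terminal) (a : G.Terminal) :
    G.discountedProb β y v a = if (a : V) = v then 1 else 0 := by
  simp [discountedProb, discountedTransition_pow_of_terminal β y hv]

/-- The limit in `β` passes through the supremum over `k`: each term is continuous in `β`, which
gives the lower bound, and for `β < 1` all terms lie below the undiscounted limit. -/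
theorem tendsto_discountedProb (y : G.Profile) (v : V) (a : G.Terminal) :
    Tendsto (fun β => G.discountedProb β y v a) (𝓝[<] 1)
      (𝓝 (G.limitDistribution y v (some a))) := by
  have hmem : ∀ᶠ β : ℝ in 𝓝[<] 1, β ∈ Set.Ioo (0 : ℝ) 1 := Ioo_mem_nhdsLT one_pos
  refine tendsto_order.2 ⟨fun c hc => ?_, fun c hc => ?_⟩
  · obtain ⟨k, hk⟩ := ((G.tendsto_probTerminated y v a).eventually_const_lt hc).exists
    have hk' : c < (G.discountedTransition 1 y ^ k) v a := by
      rwa [discountedTransition_one]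
    have := ((continuous_discountedTransition_pow y k v a.1).tendsto 1).eventually_const_lt hk'
    filter_upwards [hmem, this.filter_mono nhdsWithin_le_nhds] with β hβ h
    exact h.trans_le (le_ciSup (bddAbove_discountedTransition_pow hβ.1.le hβ.2.le y v a) k)
  · filter_upwards [hmem] with β hβ
    exact (ciSup_le fun k =>
      discountedTransition_pow_le_limitDistribution hβ.1.le hβ.2.le y v a k).trans_lt hc

variable (G) in
/-- The expectation of `β ^ k * r a`, where the play terminates in `a` after `k` moves. -/
def discountedPayoff (β : ℝ) (r : G.Terminal → ℝ) (y : G.Profile) (v : V) : ℝ :=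
  ∑ a, G.discountedProb β y v a * r a

theorem discountedPayoff_of_terminal (β : ℝ) (r : G.Terminal → ℝ) (y : G.Profile)
    (a : G.Terminal) : G.discountedPayoff β r y a = r a := by
  simp [discountedPayoff, discountedProb_of_terminal β y a.2, Subtype.coe_inj]

theorem discountedPayoff_eq_sum {β : ℝ} (hβ : 0 ≤ β) (hβ' : β ≤ 1) (r : G.Terminal → ℝ)
    (y : G.Profile) {v : V} (hv : G.controller v ≠ .terminal) :
    G.discountedPayoff β r y v =
      β * ∑ w, G.transition y v w * G.discountedPayoff β r y w := by
  simp only [discountedPayoff, Finset.mul_sum]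
  rw [Finset.sum_comm]
  refine Finset.sum_congr rfl fun a _ => ?_
  rw [discountedProb_eq_sum hβ hβ' y v a, Finset.sum_mul]
  refine Finset.sum_congr rfl fun w _ => ?_
  simp only [discountedTransition, hv, if_false]
  ring

/-- The maximum principle for the discounted chain. -/
theorem nonpos_of_le_discounted {β : ℝ} (hβ : 0 ≤ β) (hβ' : β < 1) (y : G.Profile) {d : V → ℝ}
    (ht : ∀ v, G.controller v = .terminal → d v ≤ 0)
    (hd : ∀ v, G.controller v ≠ .terminal → d v ≤ β * ∑ w, G.transition y v w * d w) (v : V) :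
    d v ≤ 0 := by
  obtain ⟨m, -, hm⟩ := Finset.exists_max_image Finset.univ d ⟨v, Finset.mem_univ v⟩
  refine (hm v (Finset.mem_univ v)).trans ?_
  by_cases hmt : G.controller m = .terminal
  · exact ht m hmt
  · have h : ∑ w, G.transition y m w * d w ≤ d m := by
      calc ∑ w, G.transition y m w * d w ≤ ∑ w, G.transition y m w * d m :=
            Finset.sum_le_sum fun w hw =>
              mul_le_mul_of_nonneg_left (hm w hw) (G.transition_nonneg y m w)
        _ = d m := by rw [← Finset.sum_mul, G.sum_transition, one_mul]
    -- At a nonterminal maximum `m` this gives `d m ≤ β * d m`, and `β < 1` forces `d m ≤ 0`.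
    nlinarith [hd m hmt, mul_le_mul_of_nonneg_left h hβ]

/-- Verification principle: the difference with a supersolution satisfies the maximum principle. The
next lemma is the version for subsolutions. -/
theorem discountedPayoff_le {β : ℝ} (hβ : 0 ≤ β) (hβ' : β < 1) (r : G.Terminal → ℝ)
    (y : G.Profile) {h : V → ℝ} (ht : ∀ a : G.Terminal, r a ≤ h a)
    (hh : ∀ v, G.controller v ≠ .terminal → β * ∑ w, G.transition y v w * h w ≤ h v) (v : V) :
    G.discountedPayoff β r y v ≤ h v := by
  refine sub_nonpos.1 (nonpos_of_le_discounted hβ hβ' y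
    (d := fun v => G.discountedPayoff β r y v - h v) (fun v hv => ?_) (fun v hv => ?_) v)
  · simpa only [discountedPayoff_of_terminal β r y ⟨v, hv⟩, sub_nonpos] using ht ⟨v, hv⟩
  · simp only [mul_sub, Finset.sum_sub_distrib]
    rw [discountedPayoff_eq_sum hβ hβ'.le r y hv]
    linarith [hh v hv]

theorem le_discountedPayoff {β : ℝ} (hβ : 0 ≤ β) (hβ' : β < 1) (r : G.Terminal → ℝ)
    (y : G.Profile) {h : V → ℝ} (ht : ∀ a : G.Terminal, h a ≤ r a)
    (hh : ∀ v, G.controller v ≠ .terminal → h v ≤ β * ∑ w, G.transition y v w * h w) (v : V) :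
    h v ≤ G.discountedPayoff β r y v := by
  refine sub_nonpos.1 (nonpos_of_le_discounted hβ hβ' y
    (d := fun v => h v - G.discountedPayoff β r y v) (fun v hv => ?_) (fun v hv => ?_) v)
  · simpa only [discountedPayoff_of_terminal β r y ⟨v, hv⟩, sub_nonpos] using ht ⟨v, hv⟩
  · simp only [mul_sub, Finset.sum_sub_distrib]
    rw [discountedPayoff_eq_sum hβ hβ'.le r y hv]
    linarith [hh v hv]

end Discounting

/-! ### Pure positional strategies and policy improvement -/

section PureStrategies

variable {I V : Type*} [Fintype V] [DecidableEq V] (G : GameStructure I V)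

/-- A pure positional strategy of player `i`, extended arbitrarily to the other positions. -/
abbrev PureStrategy (i : I) : Type _ :=
  {s : V → V // ∀ v, G.controller v = .player i → G.graph.Adj v (s v)}

variable {G}

instance instNonemptyPureStrategy (i : I) : Nonempty (G.PureStrategy i) := by
  have h : ∀ v, ∃ w, G.controller v = .player i → G.graph.Adj v w := fun v => by
    by_cases hv : G.controller v = .player i
    · exact (G.exists_move v (by simp [hv])).imp fun _ hw _ => hw
    · exact ⟨v, fun hv' => absurd hv' hv⟩
  choose s hs using h
  exact ⟨⟨s, hs⟩⟩

/-- A pure positional strategy as an independently mixed strategy. -/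
def PureStrategy.toStrategy {i : I} (s : G.PureStrategy i) : G.Strategy i where
  prob v _ w := if w = s.1 v then 1 else 0
  prob_dist v h := by
    refine ⟨fun w => by dsimp only; split_ifs <;> norm_num, fun w hw => if_neg ?_, by simp⟩
    rintro rfl
    exact hw (s.2 v h)

/-- Replacing the move of a pure positional strategy in the position `v`. -/
def PureStrategy.update {i : I} (s : G.PureStrategy i) {v w : V} (hw : G.graph.Adj v w) :
    G.PureStrategy i :=
  ⟨Function.update s.1 v w, fun x hx => by
    rcases eq_or_ne x v with rfl | hxv
    · simpa using hw
    · simpa [hxv] using s.2 x hx⟩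

theorem transition_of_player (y : G.Profile) {i : I} {v : V}
    (hv : G.controller v = .player i) (w : V) :
    G.transition y v w = (y i).prob v hv w := by
  unfold transition
  split <;> rename_i h'
  · obtain rfl : i = _ := by simpa [hv] using h'
    rfl
  · simp [hv] at h'
  · simp [hv] at h'

theorem transition_of_chance (y : G.Profile) {v : V}
    (hv : G.controller v = .chance) (w : V) :
    G.transition y v w = G.q v hv w := by
  unfold transition
  split <;> rename_i h'
  · simp [hv] at h'
  · rfl
  · simp [hv] at h'

/-- The transition probabilities from a position that is not controlled by `i` do not depend on
the strategy of `i`. -/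
theorem transition_congr {i : I} {y y' : G.Profile} (h : ∀ j, j ≠ i → y' j = y j) {v : V}
    (hv : G.controller v ≠ .player i) (w : V) : G.transition y' v w = G.transition y v w := by
  rcases hc : G.controller v with j | _ | _
  · rw [transition_of_player _ hc, transition_of_player _ hc, h j]
    rintro rfl
    exact hv hc
  · rw [transition_of_chance _ hc, transition_of_chance _ hc]
  · rw [G.transition_of_terminal _ hc, G.transition_of_terminal _ hc]

variable [DecidableEq I]

/-- The situation obtained from `y` when player `i` plays the pure strategy `s`. -/
def deviate (y : G.Profile) {i : I} (s : G.PureStrategy i) : G.Profile :=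
  Function.update y i s.toStrategy

theorem deviate_of_ne (y : G.Profile) {i : I} (s : G.PureStrategy i) {j : I} (hj : j ≠ i) :
    deviate y s j = y j :=
  Function.update_of_ne hj _ _

theorem transition_deviate (y : G.Profile) {i : I} (s : G.PureStrategy i) {v : V}
    (hv : G.controller v = .player i) (w : V) :
    G.transition (deviate y s) v w = if w = s.1 v then 1 else 0 := by
  rw [transition_of_player _ hv]
  simp [deviate, PureStrategy.toStrategy]

/-- In the discounted game player `i` has a pure strategy that is a best response from all
initial positions simultaneously. -/
theorem exists_pure_discounted_best_response {β : ℝ} (hβ : 0 ≤ β) (hβ' : β < 1) {i : I}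
    (r : G.Terminal → ℝ) (y : G.Profile) :
    ∃ s : G.PureStrategy i, ∀ y' : G.Profile, (∀ j, j ≠ i → y' j = y j) → ∀ v,
      G.discountedPayoff β r y' v ≤ G.discountedPayoff β r (deviate y s) v := by
  -- Maximizing the sum over all initial positions suffices: a switch that is nowhere worse and
  -- somewhere strictly better would increase this sum.
  obtain ⟨s, hs⟩ := Finite.exists_max fun s : G.PureStrategy i =>
    ∑ v, G.discountedPayoff β r (deviate y s) v
  set f := G.discountedPayoff β r (deviate y s) with hf
  have eqn : ∀ v, G.controller v ≠ .terminal →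
      f v = β * ∑ w, G.transition (deviate y s) v w * f w :=
    fun v hv => discountedPayoff_eq_sum hβ hβ'.le r _ hv
  -- No single move improves on `s`. Otherwise switching to `w` at `v` makes `f` a subsolution for
  -- the new strategy, strict at `v`, so the sum grows.
  have opt : ∀ v w, G.controller v = .player i → G.graph.Adj v w → β * f w ≤ f v := by
    intro v w hv hw
    by_contra! hlt
    set s' := s.update hw with hs'
    have hT : ∑ x, G.transition (deviate y s') v x * f x = f w := by
      simp [transition_deviate _ _ hv, hs', PureStrategy.update]
    have hsub : ∀ x, G.controller x ≠ .terminal →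
        f x ≤ β * ∑ z, G.transition (deviate y s') x z * f z := by
      intro x hx
      rcases eq_or_ne x v with rfl | hxv
      · rw [hT]; exact hlt.le
      · rw [eqn x hx]
        refine le_of_eq ?_
        congr 1
        refine Finset.sum_congr rfl fun z _ => ?_
        congr 1
        by_cases hxi : G.controller x = .player i
        · simp [transition_deviate _ _ hxi, hs', PureStrategy.update, hxv]
        · exact transition_congr (fun j hj => by rw [deviate_of_ne _ _ hj, deviate_of_ne _ _ hj])
            hxi z
    have hle := le_discountedPayoff hβ hβ' r (deviate y s')
      (fun a => (discountedPayoff_of_terminal β r _ a).le) hsub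
    have hstrict : f v < G.discountedPayoff β r (deviate y s') v := by
      rw [discountedPayoff_eq_sum hβ hβ'.le r _ (by simp [hv])]
      refine hlt.trans_le ?_
      rw [← hT]
      exact mul_le_mul_of_nonneg_left (Finset.sum_le_sum fun x _ =>
        mul_le_mul_of_nonneg_left (hle x) (G.transition_nonneg _ _ _)) hβ
    exact (hs s').not_gt
      (Finset.sum_lt_sum (fun x _ => hle x) ⟨v, Finset.mem_univ v, hstrict⟩)
  -- By `opt`, `f` is a supersolution for every deviation of player `i`, mixed ones included, since
  -- these only average over moves.
  refine ⟨s, fun y' hy' => discountedPayoff_le hβ hβ' r y'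
    (fun a => (discountedPayoff_of_terminal β r _ a).ge) fun v hv => ?_⟩
  change β * ∑ w, G.transition y' v w * f w ≤ f v
  by_cases hvi : G.controller v = .player i
  · simp only [transition_of_player y' hvi]
    obtain ⟨h0, hsupp, h1⟩ := (y' i).prob_dist v hvi
    calc β * ∑ w, (y' i).prob v hvi w * f w
        = ∑ w, (y' i).prob v hvi w * (β * f w) := by
          rw [Finset.mul_sum]
          exact Finset.sum_congr rfl fun w _ => by ring
      _ ≤ ∑ w, (y' i).prob v hvi w * f v := by
          refine Finset.sum_le_sum fun w _ => ?_
          by_cases hw : G.graph.Adj v w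
          · exact mul_le_mul_of_nonneg_left (opt v w hvi hw) (h0 w)
          · simp [hsupp w hw]
      _ = f v := by rw [← Finset.sum_mul, h1, one_mul]
  · rw [eqn v hv]
    refine le_of_eq ?_
    congr 1
    refine Finset.sum_congr rfl fun w _ => ?_
    rw [transition_congr (fun j hj => (hy' j hj).trans (deviate_of_ne y s hj).symm) hvi w]

end PureStrategies

/-! ### Passage to the undiscounted limit -/

section EffectivePayoff

variable {I V : Type*} [Fintype V] [DecidableEq V] {G : GameStructure I V}

theorem limitDistribution_none (y : G.Profile) (v : V) :
    G.limitDistribution y v none = 1 - ∑ a, G.limitDistribution y v (some a) := by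
  refine eq_sub_of_add_eq' (tendsto_nhds_unique ((tendsto_finsetSum _ fun a _ =>
    G.tendsto_probTerminated y v a).add (G.tendsto_probRunning y v)) ?_)
  simp only [sum_probTerminated_add_probRunning]
  exact tendsto_const_nhds

/-- Shifting the payoff by its value at `c` makes infinite plays pay `0`, as they do under
discounting. -/
theorem effectivePayoff_eq (u : I → G.Outcome → ℝ) (y : G.Profile) (v : V) (i : I) :
    G.effectivePayoff u y v i = u i none +
      ∑ a, G.limitDistribution y v (some a) * (u i (some a) - u i none) := by
  simp only [effectivePayoff, Fintype.sum_option, limitDistribution_none, mul_sub,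
    Finset.sum_sub_distrib, ← Finset.sum_mul]
  ring

theorem tendsto_discountedPayoff (u : I → G.Outcome → ℝ) (y : G.Profile) (v : V) (i : I) :
    Tendsto (fun β => G.discountedPayoff β (fun a => u i (some a) - u i none) y v) (𝓝[<] 1)
      (𝓝 (G.effectivePayoff u y v i - u i none)) := by
  rw [effectivePayoff_eq, add_sub_cancel_left]
  exact tendsto_finsetSum _ fun a _ => (tendsto_discountedProb y v a).mul_const _

/-- Each player has a response to `y` that is a best response from all initial positions
simultaneously. -/
theorem exists_uniform_best_response [DecidableEq I] (u : I → G.Outcome → ℝ) (y : G.Profile)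
    (i : I) :
    ∃ z : G.Profile, (∀ j, j ≠ i → z j = y j) ∧
      ∀ y' : G.Profile, (∀ j, j ≠ i → y' j = y j) → ∀ v,
        G.effectivePayoff u y' v i ≤ G.effectivePayoff u z v i := by
  suffices ∃ s : G.PureStrategy i, ∀ y' : G.Profile, (∀ j, j ≠ i → y' j = y j) → ∀ v,
      G.effectivePayoff u y' v i ≤ G.effectivePayoff u (deviate y s) v i from
    this.elim fun s hs => ⟨deviate y s, fun j hj => deviate_of_ne y s hj, hs⟩
  by_contra! hc
  choose y' hy' v hv using hc
  have hmem : ∀ᶠ β : ℝ in 𝓝[<] 1, β ∈ Set.Ioo (0 : ℝ) 1 := Ioo_mem_nhdsLT one_pos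
  -- Each `s` has a counterexample whose strict inequality persists for `β` close to `1`. There are
  -- finitely many `s`, so one `β` serves them all, contradicting the discounted best response.
  have hev := eventually_all.2 fun s : G.PureStrategy i =>
    (tendsto_discountedPayoff u (deviate y s) (v s) i).eventually_lt
      (tendsto_discountedPayoff u (y' s) (v s) i) (sub_lt_sub_right (hv s) _)
  obtain ⟨β, hβ, hlt⟩ := (hmem.and hev).exists
  obtain ⟨s, hs⟩ := exists_pure_discounted_best_response hβ.1.le hβ.2
    (fun a => u i (some a) - u i none) y (i := i)
  exact (hlt s).not_ge (hs (y' s) (hy' s) (v s))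

end EffectivePayoff

/-! ### The extension as an average over initial positions -/

section InitializingExtension

variable {I V : Type*} [Fintype V] {G : GameStructure I V} {q₀ : V → ℝ}
  {hq₀ : G.IsInitialDistribution q₀}

/-- The situation of `G` that is given by a situation of its initializing extension. -/
def restrictProfile (Y : (G.extension q₀ hq₀).Profile) : G.Profile := fun i =>
  { prob := fun v h w => (Y i).prob (some v) h (some w)
    prob_dist := fun v h => by
      obtain ⟨h0, hsupp, h1⟩ := (Y i).prob_dist (some v) h
      refine ⟨fun w => h0 _, fun w hw => hsupp (some w) hw, ?_⟩
      rwa [Fintype.sum_option, hsupp none (fun hn => hn), zero_add] at h1 }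

theorem restrictProfile_extensionProfile (y : G.Profile) :
    restrictProfile (G.extensionProfile q₀ hq₀ y) = y :=
  rfl

/-- The terminal positions of the extension are those of `G`. -/
def terminalEquiv (G : GameStructure I V) (q₀ : V → ℝ) (hq₀ : G.IsInitialDistribution q₀) :
    G.Terminal ≃ (G.extension q₀ hq₀).Terminal where
  toFun a := ⟨some a.1, a.2⟩
  invFun
    | ⟨some a, h⟩ => ⟨a, h⟩
  left_inv _ := rfl
  right_inv
    | ⟨some _, _⟩ => rfl

variable [DecidableEq V]

theorem extension_transition_some_some (Y : (G.extension q₀ hq₀).Profile) (v w : V) :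
    (G.extension q₀ hq₀).transition Y (some v) (some w) =
      G.transition (restrictProfile Y) v w := by
  rcases hc : G.controller v with j | _ | _
  · rw [transition_of_player _ hc]
    exact transition_of_player Y (G := G.extension q₀ hq₀) (v := some v) hc _
  · rw [transition_of_chance _ hc]
    exact transition_of_chance Y (G := G.extension q₀ hq₀) (v := some v) hc _
  · rw [G.transition_of_terminal _ hc]
    refine ((G.extension q₀ hq₀).transition_of_terminal Y (v := some v) hc _).trans ?_
    simp

theorem extension_transition_none_right (Y : (G.extension q₀ hq₀).Profile) (v : Option V) :
    (G.extension q₀ hq₀).transition Y v none = 0 := by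
  rcases hc : (G.extension q₀ hq₀).controller v with j | _ | _
  · rw [transition_of_player _ hc]
    exact ((Y j).prob_dist v hc).2.1 none (by cases v <;> exact fun h => h)
  · rw [transition_of_chance _ hc]
    exact ((G.extension q₀ hq₀).q_dist v hc).2.1 none (by cases v <;> exact fun h => h)
  · rw [transition_of_terminal _ _ hc]
    cases v with
    | none => cases hc
    | some v => simp

theorem extension_transition_none_some (Y : (G.extension q₀ hq₀).Profile) (w : V) :
    (G.extension q₀ hq₀).transition Y none (some w) = q₀ w :=
  transition_of_chance Y (G := G.extension q₀ hq₀) (v := none) rfl (some w)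

theorem extension_transition_pow_some_some (Y : (G.extension q₀ hq₀).Profile) (k : ℕ) (v w : V) :
    ((G.extension q₀ hq₀).transition Y ^ k) (some v) (some w) =
      (G.transition (restrictProfile Y) ^ k) v w := by
  induction k generalizing v with
  | zero => simp [Matrix.one_apply]
  | succ k ih =>
    simp only [pow_succ', Matrix.mul_apply, Fintype.sum_option, extension_transition_none_right,
      extension_transition_some_some, ih, zero_mul, zero_add]

theorem extension_limitDistribution_some (Y : (G.extension q₀ hq₀).Profile) (a : G.Terminal) :
    (G.extension q₀ hq₀).limitDistribution Y none (some (terminalEquiv G q₀ hq₀ a)) =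
      ∑ v, q₀ v * G.limitDistribution (restrictProfile Y) v (some a) := by
  refine tendsto_nhds_unique (((G.extension q₀ hq₀).tendsto_probTerminated Y none _).comp
    (tendsto_add_atTop_nat 1)) ?_
  -- The first of the `k + 1` moves is the draw of the initial position; no move returns to `none`,
  -- so the other `k` are played in `G`.
  have h : ∀ k, (G.extension q₀ hq₀).probTerminated Y none (terminalEquiv G q₀ hq₀ a) (k + 1) =
      ∑ v, q₀ v * G.probTerminated (restrictProfile Y) v a k := fun k => by
    unfold probTerminated
    change ((G.extension q₀ hq₀).transition Y ^ (k + 1)) none (some a.1) = _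
    simp only [pow_succ', Matrix.mul_apply, Fintype.sum_option, extension_transition_none_right,
      extension_transition_none_some, extension_transition_pow_some_some, zero_mul, zero_add]
  simp only [Function.comp_def, h]
  exact tendsto_finsetSum _ fun v _ =>
    (G.tendsto_probTerminated (restrictProfile Y) v a).const_mul _

/-- The effective payoff in the extension is the mean of the effective payoffs of `G` over the
random initial position. -/
theorem extension_effectivePayoff (u : I → G.Outcome → ℝ) (Y : (G.extension q₀ hq₀).Profile)
    (i : I) :
    (G.extension q₀ hq₀).effectivePayoff (G.extensionPayoff q₀ hq₀ u) Y none i =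
      ∑ v, q₀ v * G.effectivePayoff u (restrictProfile Y) v i := by
  simp only [effectivePayoff_eq, mul_add, Finset.sum_add_distrib]
  -- Since `q₀` has total mass one, the constant `u i none` averages to itself.
  rw [← Finset.sum_mul, hq₀.2.2, one_mul, ← (terminalEquiv G q₀ hq₀).sum_comp]
  congr 1
  simp only [extension_limitDistribution_some, Finset.sum_mul, Finset.mul_sum]
  rw [Finset.sum_comm]
  exact Finset.sum_congr rfl fun v _ => Finset.sum_congr rfl fun a _ => mul_assoc _ _ _

/-- Profiles of the two games correspond, so deviations in the extension are exactly deviations in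
`G`, judged by the average payoff. -/
theorem isNE_extension_iff (u : I → G.Outcome → ℝ) (y : G.Profile) :
    (G.extension q₀ hq₀).IsNE (G.extensionPayoff q₀ hq₀ u) none (G.extensionProfile q₀ hq₀ y) ↔
      ∀ (i : I) (y' : G.Profile), (∀ j, j ≠ i → y' j = y j) →
        ∑ v, q₀ v * G.effectivePayoff u y' v i ≤ ∑ v, q₀ v * G.effectivePayoff u y v i := by
  constructor
  · intro h i y' hy'
    have := h i (G.extensionProfile q₀ hq₀ y') fun j hj => by
      simp only [extensionProfile, hy' j hj]
    rwa [extension_effectivePayoff, extension_effectivePayoff, restrictProfile_extensionProfile,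
      restrictProfile_extensionProfile] at this
  · intro h i Y hY
    rw [extension_effectivePayoff, extension_effectivePayoff, restrictProfile_extensionProfile]
    refine h i (restrictProfile Y) fun j hj => ?_
    simp only [restrictProfile, hY j hj]
    rfl

end InitializingExtension

end

end GameStructure

/-! ### The two implications -/

open GameStructure
theorem proposition2 {n : ℕ} {V : Type*} [Fintype V] [DecidableEq V]
    (G : GameStructure (Fin n) V) (u : Fin n → G.Outcome → ℝ) (y : G.Profile) :
    (G.IsUNE u y →
      ∀ (q₀ : V → ℝ) (hq₀ : G.IsInitialDistribution q₀),
        (G.extension q₀ hq₀).IsNE (G.extensionPayoff q₀ hq₀ u) none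
          (G.extensionProfile q₀ hq₀ y)) ∧
    ((∃ (q₀ : V → ℝ) (hq₀ : G.IsInitialDistribution q₀),
        (∀ v, G.controller v ≠ .terminal → 0 < q₀ v) ∧
        (G.extension q₀ hq₀).IsNE (G.extensionPayoff q₀ hq₀ u) none
          (G.extensionProfile q₀ hq₀ y)) →
      G.IsUNE u y) := by
  constructor
  · intro h q₀ hq₀
    rw [isNE_extension_iff]
    intro i y' hy'
    refine Finset.sum_le_sum fun v _ => ?_
    by_cases hv : G.controller v = .terminal
    · simp [hq₀.2.1 v (fun h' => h' hv)]
    · exact mul_le_mul_of_nonneg_left (h v hv i y' hy') (hq₀.1 v)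
  · rintro ⟨q₀, hq₀, hpos, hNE⟩ v hv i y' hy'
    rw [isNE_extension_iff] at hNE
    -- The equilibrium condition is tested against `z` rather than `y'`, since `z` cannot lose at
    -- any other position.
    obtain ⟨z, hz, hbest⟩ := exists_uniform_best_response u y i
    refine (hbest y' hy' v).trans ?_
    by_contra! hlt
    exact (hNE i z hz).not_gt (Finset.sum_lt_sum
      (fun w _ => mul_le_mul_of_nonneg_left (hbest y (fun _ _ => rfl) w) (hq₀.1 w))
      ⟨v, Finset.mem_univ v, mul_lt_mul_of_pos_left hlt (hpos v hv)⟩)
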